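/- Let $V$ be a finite-dimensional vector space over a field $K$ of characteristic zero and let $s\ge 2$. An $s$-vector $P\in\Lambda^sV$ is called simple (decomposable) if $P=v_1\wedge\cdots\wedge v_s$ for some $v_1,\dots,v_s\in V$. For $p\ge q\ge 0$ let $Y^{p,q}$ be the representation of $\mathrm{GL}(V)$ attached to the Young diagram with two columns, of lengths $p$ and $q$: the quotient of $\Lambda^pV\otimes\Lambda^qV$ by the relations $$(v_1\wedge\cdots\wedge v_p)\otimes(w_1\wedge\cdots\wedge w_q)=\sum_{i=1}^p (v_1\wedge\cdots\wedge w_j\wedge\cdots\wedge v_p)\otimes(w_1\wedge\cdots\wedge v_i\wedge\cdots\wedge w_q)\qquad(1\le j\le q),$$ in which $v_i$ and $w_j$ are interchanged. It is irreducible if $p\le\dim V$ and zero otherwise, and the symmetric square $\Lambda^sV\odot\Lambda^sV$ decomposes as $Y^{s,s}\oplus Y^{s+2,s-2}\oplus Y^{s+4,s-4}\oplus\cdots$. The component of $P\otimes P$ in $Y^{p,q}$ vanishes if and only if every $\mathrm{GL}(V)$-equivariant linear map $\Lambda^sV\otimes\Lambda^sV\to Y^{p,q}$ sends $P\otimes P$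 to $0$. Then: (a) An $s$-vector $P$ is simple if and only if the component of $P\otimes P$ in $Y^{s+2,s-2}$ vanishes. (b) This is optimal: let $J$ be any non-empty set of even integers $k$ with $0\le k\le s$, $k\ne 2$ and $s+k\le\dim V$ (so that $\{Y^{s+k,s-k}\}_{k\in J}$ is any non-empty collection of other non-zero components of $\Lambda^sV\odot\Lambda^sV$). Then either there is an $s$-vector $P$ that is not simple although the components of $P\otimes P$ in $Y^{s+k,s-k}$ vanish for all $k\in J$, or every $s$-vector $P$ for which these components vanish is $0$. -/

import Mathlib

open scoped TensorProduct

noncomputable section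

namespace Plucker

section Components

variable {K G M W : Type*} [Field K] [Group G] [AddCommGroup M] [Module K M]
  [AddCommGroup W] [Module K W]

/-- The component of the vector `x` of the representation `ρ` in the irreducible representation `σ`
vanishes: `x` is killed by every `G`-equivariant linear map from `ρ` to `σ`. When `ρ` is completely
reducible, the common kernel of these maps is the sum of all irreducible summands of `ρ` that are
not isomorphic to `σ`, so this says that the projection of `x` to the `σ`-isotypic summand is zero
(see `componentVanishes_iff` for a summand of multiplicity one). -/
def ComponentVanishes (ρ : Representation K G M) (σ : Representation K G W) (x : M) : Prop :=
  ∀ f : Representation.IntertwiningMap ρ σ, f x = 0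

/-- If `ρ` is the direct sum of `σ` and of a representation `τ` which does not map to `σ`,
the component of `x` in `σ` vanishes exactly when the projection of `x` to the summand `σ` is
zero. -/
theorem componentVanishes_iff {N : Type*} [AddCommGroup N] [Module K N]
    (ρ : Representation K G M) (σ : Representation K G W) (τ : Representation K G N)
    (e : M ≃ₗ[K] W × N) (he : ∀ g x, e (ρ g x) = (σ g (e x).1, τ g (e x).2))
    (hτ : ∀ f : Representation.IntertwiningMap τ σ, f = 0) (x : M) :
    ComponentVanishes ρ σ x ↔ (e x).1 = 0 := by
  constructor
  · intro h
    exact h (LinearMap.intertwiningMap_of_isIntertwiningMap ρ σ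
      (LinearMap.fst K W N ∘ₗ e.toLinearMap) (fun g v => by simp [he]))
  · intro h f
    let F : Representation.IntertwiningMap τ σ :=
      LinearMap.intertwiningMap_of_isIntertwiningMap τ σ
        (f.toLinearMap ∘ₗ e.symm.toLinearMap ∘ₗ LinearMap.inr K W N) (fun g v => by
          have h1 : e.symm (0, τ g v) = ρ g (e.symm (0, v)) := by
            apply e.injective
            simp [he]
          have h2 := Representation.IntertwiningMap.isIntertwining ρ σ f g (e.symm (0, v))
          rw [← h1] at h2
          exact h2)
    have h3 : F (e x).2 = 0 := by rw [hτ F]; rfl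
    have h4 : f (e.symm (0, (e x).2)) = 0 := h3
    have h5 : ((0 : W), (e x).2) = e x := by rw [← h]
    rwa [h5, e.symm_apply_apply] at h4

end Components

section Exterior

variable (K V : Type*) [Field K] [AddCommGroup V] [Module K V]

/-- The usual additive group structure on `Λ^p V ⊗ Λ^q V` (a shortcut for instance search). -/
instance extTensorAddCommGroup (p q : ℕ) : AddCommGroup ((⋀[K]^p V) ⊗[K] (⋀[K]^q V)) :=
  TensorProduct.addCommGroup

/-- An `s`-vector is simple (decomposable) if it is of the form `u ∧ v ∧ ⋯ ∧ w`. -/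
def IsSimple {K V : Type*} [Field K] [AddCommGroup V] [Module K V] {s : ℕ} (P : ⋀[K]^s V) : Prop :=
  ∃ v : Fin s → V, P = exteriorPower.ιMulti K s v

/-- The representation of `GL(V)` on `Λ^p V`. -/
def extRep (p : ℕ) : Representation K (LinearMap.GeneralLinearGroup K V) (⋀[K]^p V) where
  toFun g := exteriorPower.map p (g : V →ₗ[K] V)
  map_one' := by
    rw [Units.val_one]
    exact exteriorPower.map_id
  map_mul' g h := by
    rw [Units.val_mul]
    exact exteriorPower.map_comp (h : V →ₗ[K] V) (g : V →ₗ[K] V)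

/-- The representation of `GL(V)` on `Λ^p V ⊗ Λ^q V`. -/
def extTensorRep (p q : ℕ) :
    Representation K (LinearMap.GeneralLinearGroup K V) ((⋀[K]^p V) ⊗[K] (⋀[K]^q V)) :=
  (extRep K V p).tprod (extRep K V q)

/-- The exchange relations on a Young diagram with two columns, of lengths `p` and `q`:
the span in `Λ^p V ⊗ Λ^q V` of the differences between
`(v₁ ∧ ⋯ ∧ v_p) ⊗ (w₁ ∧ ⋯ ∧ w_q)` and the sum of the `p` tensors that arise from it by interchanging
the entry `w_j` of the second column with one of the entries `v_i` of the first column. -/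
def exchangeRelations (p q : ℕ) : Submodule K ((⋀[K]^p V) ⊗[K] (⋀[K]^q V)) :=
  Submodule.span K {x | ∃ (v : Fin p → V) (w : Fin q → V) (j : Fin q),
    x = exteriorPower.ιMulti K p v ⊗ₜ[K] exteriorPower.ιMulti K q w -
      ∑ i : Fin p, exteriorPower.ιMulti K p (Function.update v i (w j)) ⊗ₜ[K]
        exteriorPower.ιMulti K q (Function.update w j (v i))}

theorem exchangeRelations_le_comap (p q : ℕ) (g : LinearMap.GeneralLinearGroup K V) :
    exchangeRelations K V p q ≤ (exchangeRelations K V p q).comap (extTensorRep K V p q g) := by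
  refine Submodule.span_le.mpr ?_
  rintro _ ⟨v, w, j, rfl⟩
  refine Submodule.subset_span ⟨(g : V →ₗ[K] V) ∘ v, (g : V →ₗ[K] V) ∘ w, j, ?_⟩
  simp [extTensorRep, extRep, exteriorPower.map_apply_ιMulti, Function.comp_update]

/-- The underlying space of `Y^{p,q}` for `p ≥ q`: the Schur module of the Young diagram with two
columns, of lengths `p` and `q`, as the quotient of `Λ^p V ⊗ Λ^q V` by the exchange relations.
(In characteristic zero the relations that exchange a single box generate the others.) -/
abbrev Y (p q : ℕ) :=
  ((⋀[K]^p V) ⊗[K] (⋀[K]^q V)) ⧸ exchangeRelations K V p q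

/-- `Y^{p,q}` as a representation of `GL(V)`. -/
def YRep (p q : ℕ) : Representation K (LinearMap.GeneralLinearGroup K V) (Y K V p q) :=
  (extTensorRep K V p q).quotient (exchangeRelations K V p q) (exchangeRelations_le_comap K V p q)

/-- The component of `P ⊗ P` in `Y^{s+k,s-k}` vanishes (used for `k ≤ s` only). -/
def SquareComponentVanishes {K V : Type*} [Field K] [AddCommGroup V] [Module K V] {s : ℕ}
    (P : ⋀[K]^s V) (k : ℕ) : Prop :=
  ComponentVanishes (extTensorRep K V s s) (YRep K V (s + k) (s - k)) (P ⊗ₜ[K] P)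

end Exterior

end Plucker

end

/-! Read `P` as an alternating form `dualForm P` on the dual space; it determines `P`.

Vanishing implies simple. Moving two vectors from the second factor to the first (`raise` twice) and
passing to the quotient is an equivariant map from `Λ^s ⊗ Λ^s` to `Y^{s+2,s-2}`. By Cramer's rule,
pairing with a family of covectors and a subfamily of it descends to the Schur module. On the image
of `P ⊗ P` this pairing is `-4` times a three-term Plücker expression, so all three-term relations
hold, for arbitrary covectors. They force `P` to be decomposable (`isSimple_of_threeTerm_eq_zero`).

Simple implies vanishing. A simple `P ≠ 0` lives on `s` basis vectors. Scaling all other basis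
vectors by `2` fixes `P ⊗ P`, but has no nonzero fixed vector on `Y^{s+k,s-k}` for `k > 0`, since `s
+ k` distinct basis vectors cannot all be among those `s` (`squareComponentVanishes_of_mem_span`).

Optimality. The same weight argument kills every component with `k > 2` for a non-simple `P` on `s +
2` basis vectors, while the component with `k = 0` vanishes only for `P = 0`. -/

open scoped TensorProduct

noncomputable section

namespace Plucker

/-! ### Multivectors as alternating forms, and linear forms on the Schur module. -/

section DualForm

variable {K V : Type*} [Field K] [AddCommGroup V] [Module K V]

/-- The alternating form on the dual space given by pairing with a multivector `P`. -/
def dualForm {s : ℕ} (P : ⋀[K]^s V) : (Module.Dual K V) [⋀^Fin s]→ₗ[K] K :=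
  (LinearMap.applyₗ P).compAlternatingMap (exteriorPower.alternatingMapToDual K V s)

theorem dualForm_apply {s : ℕ} (P : ⋀[K]^s V) (ξ : Fin s → Module.Dual K V) :
    dualForm P ξ = exteriorPower.alternatingMapToDual K V s ξ P := rfl

theorem dualForm_ιMulti {s : ℕ} (v : Fin s → V) (ξ : Fin s → Module.Dual K V) :
    dualForm (exteriorPower.ιMulti K s v) ξ = Matrix.det (.of fun i j ↦ ξ j (v i)) := by
  rw [dualForm_apply, exteriorPower.alternatingMapToDual_apply_ιMulti]

theorem dualForm_add {s : ℕ} (P Q : ⋀[K]^s V) (ξ : Fin s → Module.Dual K V) :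
    dualForm (P + Q) ξ = dualForm P ξ + dualForm Q ξ := by
  simp [dualForm_apply]

theorem eq_of_dualForm_eq {s : ℕ} {P Q : ⋀[K]^s V} (h : ∀ ξ, dualForm P ξ = dualForm Q ξ) :
    P = Q := by
  classical
  let b := Module.Free.chooseBasis K V
  let : LinearOrder (Module.Free.ChooseBasisIndex K V) := linearOrderOfSTO WellOrderingRel
  refine (b.exteriorPower s).ext_elem fun i ↦ ?_
  have := h (b.coord ∘ Set.powersetCard.ofFinEmbEquiv.symm i)
  rw [exteriorPower.basis_repr_apply, exteriorPower.basis_repr_apply]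
  simpa [exteriorPower.ιMultiDual, exteriorPower.ιMulti_family, exteriorPower.pairingDual,
    dualForm_apply] using this

/-- The linear form on `Λ^p V ⊗ Λ^q V` given by families of `p` and of `q` covectors. -/
def tensorForm {p q : ℕ} (ξ : Fin p → Module.Dual K V) (ζ : Fin q → Module.Dual K V) :
    Module.Dual K ((⋀[K]^p V) ⊗[K] (⋀[K]^q V)) :=
  TensorProduct.dualDistrib K _ _
    (exteriorPower.alternatingMapToDual K V p ξ ⊗ₜ exteriorPower.alternatingMapToDual K V q ζ)

theorem tensorForm_tmul {p q : ℕ} (ξ : Fin p → Module.Dual K V) (ζ : Fin q → Module.Dual K V)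
    (P : ⋀[K]^p V) (Q : ⋀[K]^q V) :
    tensorForm ξ ζ (P ⊗ₜ Q) = dualForm P ξ * dualForm Q ζ := by
  simp [tensorForm, dualForm_apply]

theorem tensorForm_ιMulti {p q : ℕ} (ξ : Fin p → Module.Dual K V) (ζ : Fin q → Module.Dual K V)
    (v : Fin p → V) (w : Fin q → V) :
    tensorForm ξ ζ (exteriorPower.ιMulti K p v ⊗ₜ exteriorPower.ιMulti K q w) =
      Matrix.det (.of fun i j ↦ ξ j (v i)) * Matrix.det (.of fun i j ↦ ζ j (w i)) := by
  rw [tensorForm_tmul, dualForm_ιMulti, dualForm_ιMulti]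

theorem tensorForm_eq_zero_right {p q : ℕ} (ξ : Fin p → Module.Dual K V)
    {ζ : Fin q → Module.Dual K V} (h : ¬ Function.Injective ζ) : tensorForm ξ ζ = 0 := by
  rw [tensorForm, AlternatingMap.map_eq_zero_of_not_injective _ _ h]
  simp

/-- A linear form given by covectors `ξ` on the first and a subfamily of `ξ` on the second factor
is a linear form on the Schur module, by Cramer's rule. -/
theorem tensorForm_eq_zero_of_mem_exchangeRelations {p q : ℕ} (ξ : Fin p → Module.Dual K V)
    (f : Fin q → Fin p) {x : (⋀[K]^p V) ⊗[K] (⋀[K]^q V)} (hx : x ∈ exchangeRelations K V p q) :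
    tensorForm ξ (ξ ∘ f) x = 0 := by
  induction hx using Submodule.span_induction with
  | zero => simp
  | add x y _ _ hx hy => rw [map_add, hx, hy, add_zero]
  | smul c x _ hx => rw [map_smul, hx, smul_zero]
  | mem x hx =>
    obtain ⟨v, w, j, rfl⟩ := hx
    rw [map_sub, map_sum, tensorForm_ιMulti]
    simp only [tensorForm_ιMulti]
    let A : Matrix (Fin p) (Fin p) K := .of fun i k ↦ ξ k (v i)
    let B : Matrix (Fin q) (Fin q) K := .of fun i k ↦ (ξ ∘ f) k (w i)
    let c : Fin p → K := fun k ↦ ξ k (w j)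
    have hA : ∀ i, (Matrix.of fun i' k ↦ ξ k (Function.update v i (w j) i')) = A.updateRow i c := by
      intro i
      ext i' k
      by_cases h : i' = i
      · subst h; simp [c]
      · simp [h, A]
    have hB : ∀ i, (Matrix.of fun i' k ↦ (ξ ∘ f) k (Function.update w j (v i) i')) =
        B.updateRow j (fun k ↦ A i (f k)) := by
      intro i
      ext i' k
      by_cases h : i' = j
      · subst h; simp [A]
      · simp [h, B]
    simp only [hA, hB]
    -- The covectors of the second factor are among those of the first, so row `j` of `B` is `c ∘
    -- f`. Applying `L` to Cramer's identity `key` thus turns its right side into `det A * det B`.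
    let L : (Fin p → K) →ₗ[K] K :=
      ((Matrix.detRowAlternating (n := Fin q) (R := K)).toMultilinearMap.toLinearMap B j) ∘ₗ
        LinearMap.funLeft K K f
    have hL : ∀ u, L u = (B.updateRow j (fun k ↦ u (f k))).det := fun u ↦ rfl
    have key : ∑ i, (A.updateRow i c).det • A i = A.det • c := by
      have h := Matrix.mulVec_cramer A.transpose c
      rw [Matrix.det_transpose] at h
      rw [← h]
      ext k
      simp [Matrix.mulVec, dotProduct, Matrix.cramer_apply, Matrix.updateCol_transpose,
        Matrix.det_transpose, mul_comm]
    have hsum : ∑ i, (A.updateRow i c).det * (B.updateRow j (fun k ↦ A i (f k))).det =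
        A.det * B.det := by
      have h2 := congrArg L key
      simp only [map_sum, map_smul, smul_eq_mul] at h2
      refine h2.trans ?_
      rw [hL]
      congr 2
      ext i k
      by_cases h : i = j
      · subst h; simp [c, B]
      · simp [h]
    rw [hsum]
    exact sub_self _

end DualForm

/-! ### The equivariant map moving one vector between the factors. -/

section Raise

variable (K V : Type*) [Field K] [AddCommGroup V] [Module K V]

/-- The map `v ↦ (v ∧ ·)` on `Λ^p V`. -/
def wedgeLeft (p : ℕ) : V →ₗ[K] (⋀[K]^p V →ₗ[K] ⋀[K]^(p + 1) V) :=
  exteriorPower.alternatingMapLinearEquiv.toLinearMap ∘ₗ (exteriorPower.ιMulti K (p + 1)).curryLeft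

theorem wedgeLeft_ιMulti (p : ℕ) (x : V) (v : Fin p → V) :
    wedgeLeft K V p x (exteriorPower.ιMulti K p v) =
      exteriorPower.ιMulti K (p + 1) (Matrix.vecCons x v) := by
  simp [wedgeLeft]

/-- The map `Λ^p V ⊗ Λ^(q+1) V → Λ^(p+1) V ⊗ Λ^q V` which moves one vector from the second factor
to the first one. -/
def raise (p q : ℕ) :
    (⋀[K]^p V) ⊗[K] (⋀[K]^(q + 1) V) →ₗ[K] (⋀[K]^(p + 1) V) ⊗[K] (⋀[K]^q V) :=
  -- The second factor is the outer variable: alternating over the choice of the vector taken from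
  -- it makes the map well defined.
  TensorProduct.lift <| LinearMap.flip <| exteriorPower.alternatingMapLinearEquiv <|
    AlternatingMap.alternatizeUncurryFin
      { toFun := fun x ↦ ((LinearMap.lcomp K _ (wedgeLeft K V p x)) ∘ₗ
          (TensorProduct.mk K (⋀[K]^(p + 1) V) (⋀[K]^q V)).flip).compAlternatingMap
            (exteriorPower.ιMulti K q)
        map_add' := fun x y ↦ by ext; simp
        map_smul' := fun c x ↦ by ext; simp }

theorem raise_ιMulti (p q : ℕ) (v : Fin p → V) (w : Fin (q + 1) → V) :
    raise K V p q (exteriorPower.ιMulti K p v ⊗ₜ exteriorPower.ιMulti K (q + 1) w) =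
      ∑ j : Fin (q + 1), (-1 : K) ^ (j : ℕ) •
        (exteriorPower.ιMulti K (p + 1) (Matrix.vecCons (w j) v) ⊗ₜ[K]
          exteriorPower.ιMulti K q (j.removeNth w)) := by
  rw [raise, TensorProduct.lift.tmul, LinearMap.flip_apply,
    exteriorPower.alternatingMapLinearEquiv_apply_ιMulti,
    AlternatingMap.alternatizeUncurryFin_apply, LinearMap.sum_apply]
  refine Finset.sum_congr rfl fun j _ ↦ ?_
  rcases neg_one_pow_eq_or ℤ (j : ℕ) with h | h
  · have h' : (-1 : K) ^ (j : ℕ) = 1 := by exact_mod_cast congrArg (Int.cast (R := K)) h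
    simp [h, h', wedgeLeft_ιMulti]
  · have h' : (-1 : K) ^ (j : ℕ) = -1 := by exact_mod_cast congrArg (Int.cast (R := K)) h
    simp [h, h', wedgeLeft_ιMulti]

variable {K V} in
theorem extTensor_ext {p q : ℕ} {N : Type*} [AddCommGroup N] [Module K N]
    {f g : (⋀[K]^p V) ⊗[K] (⋀[K]^q V) →ₗ[K] N}
    (h : ∀ v w, f (exteriorPower.ιMulti K p v ⊗ₜ exteriorPower.ιMulti K q w) =
      g (exteriorPower.ιMulti K p v ⊗ₜ exteriorPower.ιMulti K q w)) : f = g := by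
  ext v w
  exact h v w

theorem extTensorRep_ιMulti (p q : ℕ) (g : LinearMap.GeneralLinearGroup K V)
    (v : Fin p → V) (w : Fin q → V) :
    extTensorRep K V p q g (exteriorPower.ιMulti K p v ⊗ₜ exteriorPower.ιMulti K q w) =
      exteriorPower.ιMulti K p (fun i ↦ (g : V →ₗ[K] V) (v i)) ⊗ₜ
        exteriorPower.ιMulti K q (fun i ↦ (g : V →ₗ[K] V) (w i)) := by
  simp [extTensorRep, extRep, exteriorPower.map_apply_ιMulti, Function.comp_def]

theorem raise_extTensorRep (p q : ℕ) (g : LinearMap.GeneralLinearGroup K V)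
    (x : (⋀[K]^p V) ⊗[K] (⋀[K]^(q + 1) V)) :
    raise K V p q (extTensorRep K V p (q + 1) g x) =
      extTensorRep K V (p + 1) q g (raise K V p q x) := by
  suffices h : raise K V p q ∘ₗ extTensorRep K V p (q + 1) g =
      extTensorRep K V (p + 1) q g ∘ₗ raise K V p q from LinearMap.congr_fun h x
  refine extTensor_ext fun v w ↦ ?_
  simp only [LinearMap.comp_apply, extTensorRep_ιMulti, raise_ιMulti, map_sum, map_smul]
  refine Finset.sum_congr rfl fun j _ ↦ ?_
  congr 3
  ext i
  refine Fin.cases ?_ (fun i ↦ ?_) i <;> simp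

variable {K V} in
/-- The transpose of `raise` in terms of families of covectors. -/
theorem tensorForm_raise {p q : ℕ} (ξ : Fin (p + 1) → Module.Dual K V)
    (ζ : Fin q → Module.Dual K V) (x : (⋀[K]^p V) ⊗[K] (⋀[K]^(q + 1) V)) :
    tensorForm ξ ζ (raise K V p q x) =
      ∑ i : Fin (p + 1), (-1 : K) ^ (i : ℕ) *
        tensorForm (i.removeNth ξ) (Matrix.vecCons (ξ i) ζ) x := by
  suffices h : tensorForm ξ ζ ∘ₗ raise K V p q = ∑ i : Fin (p + 1), (-1 : K) ^ (i : ℕ) •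
      tensorForm (i.removeNth ξ) (Matrix.vecCons (ξ i) ζ) by
    simpa using LinearMap.congr_fun h x
  refine extTensor_ext fun v w ↦ ?_
  simp only [LinearMap.comp_apply, raise_ιMulti, map_sum, map_smul, tensorForm_ιMulti,
    LinearMap.sum_apply, LinearMap.smul_apply, smul_eq_mul]
  -- Laplace expansion along the new row on one side and along the new column on the other gives the
  -- same double sum.
  have h1 : ∀ j : Fin (q + 1), Matrix.det (.of fun i k ↦ ξ k (Matrix.vecCons (w j) v i)) =
      ∑ i : Fin (p + 1), (-1 : K) ^ (i : ℕ) * ξ i (w j) *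
        Matrix.det (.of fun l k ↦ (i.removeNth ξ) k (v l)) := by
    intro j
    rw [Matrix.det_succ_row_zero]
    rfl
  have h2 : ∀ i : Fin (p + 1),
      Matrix.det (.of fun l k ↦ (Matrix.vecCons (ξ i) ζ : Fin (q + 1) → _) k (w l)) =
      ∑ j : Fin (q + 1), (-1 : K) ^ (j : ℕ) * ξ i (w j) *
        Matrix.det (.of fun l k ↦ ζ k (j.removeNth w l)) := by
    intro i
    rw [Matrix.det_succ_column_zero]
    rfl
  simp only [h1, h2, Finset.mul_sum, Finset.sum_mul]
  rw [Finset.sum_comm]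
  refine Finset.sum_congr rfl fun i _ ↦ Finset.sum_congr rfl fun j _ ↦ ?_
  ring

end Raise

/-! ### Three-term Plücker relations from the vanishing of a component. -/

section ThreeTerm

variable {K V : Type*} [Field K] [AddCommGroup V] [Module K V]

theorem removeNth_zero_vecCons {M : Type*} {n : ℕ} (a : M) (f : Fin n → M) :
    Fin.removeNth 0 (Matrix.vecCons a f : Fin (n + 1) → M) = f := rfl

theorem removeNth_succ_vecCons {M : Type*} {n : ℕ} (i : Fin (n + 1)) (a : M)
    (f : Fin (n + 1) → M) :
    Fin.removeNth i.succ (Matrix.vecCons a f : Fin (n + 2) → M) =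
      Matrix.vecCons a (i.removeNth f) := by
  ext k
  refine Fin.cases ?_ (fun k ↦ ?_) k <;> simp [Fin.removeNth]

theorem map_vecCons_swap {M N : Type*} [AddCommGroup M] [Module K M] [AddCommGroup N] [Module K N]
    {n : ℕ} (A : M [⋀^Fin (n + 2)]→ₗ[K] N) (a b : M) (f : Fin n → M) :
    A (Matrix.vecCons b (Matrix.vecCons a f)) = -A (Matrix.vecCons a (Matrix.vecCons b f)) := by
  rw [← A.map_swap _ (zero_ne_one (α := Fin (n + 2)))]
  congr 1
  ext k
  refine Fin.cases ?_ (fun k ↦ Fin.cases ?_ (fun k ↦ ?_) k) k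
  · simp
  · simp
  · rw [Function.comp_apply, Equiv.swap_apply_of_ne_of_ne]
    · simp
    · exact Fin.succ_ne_zero _
    · rw [← Fin.succ_zero_eq_one, Ne, Fin.succ_inj]
      exact Fin.succ_ne_zero _

/-- The expression `A(a,b)A(c,d) - A(a,c)A(b,d) + A(a,d)A(b,c)` (with remaining arguments `α`)
whose vanishing is the three-term Plücker relation. -/
def threeTerm {M : Type*} [AddCommGroup M] [Module K M] {t : ℕ} (A : M [⋀^Fin (t + 2)]→ₗ[K] K)
    (a b c d : M) (α : Fin t → M) : K :=
  A (Matrix.vecCons a (Matrix.vecCons b α)) * A (Matrix.vecCons c (Matrix.vecCons d α)) -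
  A (Matrix.vecCons a (Matrix.vecCons c α)) * A (Matrix.vecCons b (Matrix.vecCons d α)) +
  A (Matrix.vecCons a (Matrix.vecCons d α)) * A (Matrix.vecCons b (Matrix.vecCons c α))

theorem not_injective_vecCons_self {M : Type*} {t : ℕ} (α : Fin t → M) (k : Fin t) :
    ¬ Function.Injective (Matrix.vecCons (α k) α : Fin (t + 1) → M) := fun h ↦
  (Fin.succ_ne_zero k).symm (h (a₁ := 0) (a₂ := k.succ) (by simp))

theorem not_injective_vecCons_vecCons_self {M : Type*} {t : ℕ} (a : M) (α : Fin t → M)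
    (k : Fin t) :
    ¬ Function.Injective (Matrix.vecCons (α k) (Matrix.vecCons a α) : Fin (t + 2) → M) := fun h ↦
  (Fin.succ_ne_zero k.succ).symm (h (a₁ := 0) (a₂ := k.succ.succ) (by simp))

theorem tensorForm_raise_square {t : ℕ} (P : ⋀[K]^(t + 2) V) (a b c d : Module.Dual K V)
    (α : Fin t → Module.Dual K V) :
    tensorForm (Matrix.vecCons b (Matrix.vecCons c (Matrix.vecCons d α))) (Matrix.vecCons a α)
      (raise K V (t + 2) (t + 1) (P ⊗ₜ P)) = -threeTerm (dualForm P) a b c d α := by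
  rw [tensorForm_raise]
  simp only [Fin.sum_univ_succ, Fin.val_zero, Fin.val_succ, removeNth_zero_vecCons,
    removeNth_succ_vecCons, Matrix.cons_val_zero, Matrix.cons_val_succ]
  -- Moving a covector of `α` would repeat it in the second family, so only the terms moving `b`,
  -- `c`, `d` survive.
  rw [Finset.sum_eq_zero]
  · simp only [tensorForm_tmul, threeTerm, map_vecCons_swap (dualForm P) a]
    ring
  · intro k _
    rw [tensorForm_eq_zero_right _ (not_injective_vecCons_vecCons_self _ _ _)]
    simp

/-- The three-term expression is alternating in `a, b, c, d`, so the four surviving terms agree with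
their signs; this is the factor `4`. -/
theorem tensorForm_raise_raise_square {t : ℕ} (P : ⋀[K]^(t + 2) V) (a b c d : Module.Dual K V)
    (α : Fin t → Module.Dual K V) :
    tensorForm (Matrix.vecCons a (Matrix.vecCons b (Matrix.vecCons c (Matrix.vecCons d α)))) α
      (raise K V (t + 3) t (raise K V (t + 2) (t + 1) (P ⊗ₜ P))) =
      -4 * threeTerm (dualForm P) a b c d α := by
  rw [tensorForm_raise]
  simp only [Fin.sum_univ_succ, Fin.val_zero, Fin.val_succ, removeNth_zero_vecCons,
    removeNth_succ_vecCons, Matrix.cons_val_zero, Matrix.cons_val_succ]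
  rw [Finset.sum_eq_zero]
  · simp only [tensorForm_raise_square, threeTerm]
    rw [map_vecCons_swap (dualForm P) a b, map_vecCons_swap (dualForm P) a c,
      map_vecCons_swap (dualForm P) a d, map_vecCons_swap (dualForm P) b c,
      map_vecCons_swap (dualForm P) b d, map_vecCons_swap (dualForm P) c d]
    ring
  · intro k _
    rw [tensorForm_eq_zero_right _ (not_injective_vecCons_self _ _)]
    simp

theorem SquareComponentVanishes.threeTerm_eq_zero [CharZero K] {t : ℕ} {P : ⋀[K]^(t + 2) V}
    (h : SquareComponentVanishes P 2) (a b c d : Module.Dual K V) (α : Fin t → Module.Dual K V) :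
    threeTerm (dualForm P) a b c d α = 0 := by
  let f : (⋀[K]^(t + 2) V) ⊗[K] (⋀[K]^(t + 2) V) →ₗ[K] Y K V (t + 4) t :=
    (exchangeRelations K V (t + 4) t).mkQ ∘ₗ raise K V (t + 3) t ∘ₗ raise K V (t + 2) (t + 1)
  have hf : ∀ g x, f (extTensorRep K V (t + 2) (t + 2) g x) = YRep K V (t + 4) t g (f x) := by
    intro g x
    simp only [f, LinearMap.comp_apply, raise_extTensorRep]
    rfl
  have h0 : f (P ⊗ₜ P) = 0 := h (LinearMap.intertwiningMap_of_isIntertwiningMap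
    (extTensorRep K V (t + 2) (t + 2)) (YRep K V (t + 4) t) f hf)
  have h1 := tensorForm_eq_zero_of_mem_exchangeRelations
    (Matrix.vecCons a (Matrix.vecCons b (Matrix.vecCons c (Matrix.vecCons d α))))
    (fun i : Fin t ↦ i.succ.succ.succ.succ) ((Submodule.Quotient.mk_eq_zero _).1 h0)
  have h2 := (tensorForm_raise_raise_square P a b c d α).symm.trans h1
  simpa using h2

/-- The quotient map itself is equivariant, and pairing `P ⊗ P` with the same covectors twice yields
the square of a value of `dualForm P`. -/
theorem SquareComponentVanishes.eq_zero {s : ℕ} {P : ⋀[K]^s V}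
    (h : SquareComponentVanishes P 0) : P = 0 := by
  have h0 : (exchangeRelations K V s s).mkQ (P ⊗ₜ P) = 0 :=
    h (LinearMap.intertwiningMap_of_isIntertwiningMap
      (extTensorRep K V s s) (YRep K V s s) (exchangeRelations K V s s).mkQ (fun g x ↦ rfl))
  refine eq_of_dualForm_eq fun ξ ↦ ?_
  have h1 := tensorForm_eq_zero_of_mem_exchangeRelations ξ id
    ((Submodule.Quotient.mk_eq_zero _).1 h0)
  rw [Function.comp_id, tensorForm_tmul, mul_self_eq_zero] at h1
  rw [h1, dualForm_apply, map_zero]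

end ThreeTerm

/-! ### Three-term relations imply decomposability. -/

section Decomposable

variable {K W : Type*} [Field K] [AddCommGroup W] [Module K W] {t : ℕ}

/-- A permutation takes slots `0, 1` to `i, j`; its sign enters each product twice and cancels. -/
theorem threeTerm_update {A : W [⋀^Fin (t + 2)]→ₗ[K] K}
    (hA : ∀ a b c d α, threeTerm A a b c d α = 0) (x : Fin (t + 2) → W) {i j : Fin (t + 2)}
    (hij : i ≠ j) (a b c d : W) :
    A (Function.update (Function.update x i a) j b) *
        A (Function.update (Function.update x i c) j d) -
      A (Function.update (Function.update x i a) j c) *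
        A (Function.update (Function.update x i b) j d) +
      A (Function.update (Function.update x i a) j d) *
        A (Function.update (Function.update x i b) j c) = 0 := by
  let σ : Equiv.Perm (Fin (t + 2)) := Equiv.swap 0 i * Equiv.swap 1 (Equiv.swap 0 i j)
  have h0 : σ 0 = i := by
    have h : Equiv.swap 0 i j ≠ 0 := by
      rw [Ne, Equiv.swap_apply_eq_iff, Equiv.swap_apply_left]
      exact hij.symm
    simp only [σ, Equiv.Perm.mul_apply]
    rw [Equiv.swap_apply_of_ne_of_ne zero_ne_one h.symm, Equiv.swap_apply_left]
  have h1 : σ 1 = j := by simp [σ]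
  have key : ∀ a b, A (Matrix.vecCons a (Matrix.vecCons b fun k ↦ x (σ k.succ.succ))) =
      Equiv.Perm.sign σ • A (Function.update (Function.update x i a) j b) := by
    intro a b
    rw [← A.map_perm]
    congr 1
    ext k
    refine Fin.cases ?_ (fun k ↦ Fin.cases ?_ (fun k ↦ ?_) k) k
    · rw [Function.comp_apply, h0, Function.update_of_ne hij, Function.update_self]
      rfl
    · rw [Function.comp_apply, Fin.succ_zero_eq_one, h1, Function.update_self]
      rfl
    · have hi : σ k.succ.succ ≠ i := by
        rw [← h0, Ne, σ.injective.eq_iff]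
        exact Fin.succ_ne_zero _
      have hj : σ k.succ.succ ≠ j := by
        rw [← h1, Ne, σ.injective.eq_iff, ← Fin.succ_zero_eq_one, Fin.succ_inj]
        exact Fin.succ_ne_zero _
      rw [Function.comp_apply, Function.update_of_ne hj, Function.update_of_ne hi]
      rfl
  have h := hA a b c d fun k ↦ x (σ k.succ.succ)
  rw [threeTerm] at h
  simp only [key] at h
  rcases Int.units_eq_one_or (Equiv.Perm.sign σ) with hs | hs
  · simpa [hs] using h
  · simpa [hs, Units.smul_def] using h

/-- The three-term relation settles two replacements. For more, the induction varies `e`: replacing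
`e i` by `e i + n i` preserves all hypotheses, and expanding in slot `i` isolates the value with one
further replacement. -/
theorem map_piecewise_eq_zero {A : W [⋀^Fin (t + 2)]→ₗ[K] K}
    (hA : ∀ a b c d α, threeTerm A a b c d α = 0) {n : Fin (t + 2) → W}
    (J : Finset (Fin (t + 2))) (hJ : J.Nonempty) (e : Fin (t + 2) → W) (he : A e ≠ 0)
    (hn : ∀ k i, A (Function.update e i (n k)) = 0) : A (J.piecewise n e) = 0 := by
  induction J using Finset.induction_on generalizing e with
  | empty => exact absurd hJ (by simp)
  | insert i J hi ih =>
    rw [Finset.piecewise_insert]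
    rcases J.eq_empty_or_nonempty with rfl | hJ'
    · rw [Finset.piecewise_empty]
      exact hn i i
    -- In the relation for `e i, e j, n i, n k` the last two products contain a single replacement,
    -- leaving `A e` times the wanted value.
    have two : ∀ k j, i ≠ j → A (Function.update (Function.update e i (n i)) j (n k)) = 0 := by
      intro k j hij
      have h := threeTerm_update hA e hij (e i) (e j) (n i) (n k)
      simp only [Function.update_eq_self, hn] at h
      simpa [he] using h
    have he' : A (Function.update e i (e i + n i)) = A e := by
      rw [A.map_update_add, hn, add_zero, Function.update_eq_self]
    have h1 := ih hJ' (Function.update e i (e i + n i)) (by rwa [he']) (by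
      intro k j
      by_cases hij : i = j
      · subst hij
        rw [Function.update_idem]
        exact hn k i
      · rw [Function.update_comm hij, A.map_update_add, ← Function.update_comm hij,
          ← Function.update_comm hij, two k j hij, Function.update_eq_self, hn, add_zero])
    have h2 := ih hJ' e he hn
    have h3 : J.piecewise n (Function.update e i (e i + n i)) =
        Function.update (J.piecewise n e) i (e i + n i) := by
      rw [Finset.update_piecewise_of_notMem _ _ _ hi]
    rw [h3, A.map_update_add] at h1
    have h4 : Function.update (J.piecewise n e) i (e i) = J.piecewise n e := by
      rw [Function.update_eq_self_iff, Finset.piecewise_eq_of_notMem _ _ _ hi]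
    rwa [h4, h2, zero_add] at h1

/-- The basis made of a family `e` with dual family `v` and of a basis of the common kernel. -/
theorem exists_basis_of_dual [FiniteDimensional K W] {n : ℕ} {v : Fin n → Module.Dual K W}
    {e : Fin n → W}
    (h : ∀ i j, v j (e i) = if i = j then 1 else 0) :
    ∃ (m : ℕ) (b : Module.Basis (Fin n ⊕ Fin m) K W),
      (∀ i, b (Sum.inl i) = e i) ∧ ∀ k j, v j (b (Sum.inr k)) = 0 := by
  let N : Submodule K W := LinearMap.ker (LinearMap.pi v)
  have hN : ∀ x, x ∈ N ↔ ∀ j, v j x = 0 := fun x ↦ by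
    simp [N, LinearMap.mem_ker, funext_iff]
  let E : (Fin n → K) × N →ₗ[K] W := (Fintype.linearCombination K e).coprod N.subtype
  have hE : ∀ c x, E (c, x) = ∑ i, c i • e i + (x : W) := fun c x ↦ by
    simp [E, Fintype.linearCombination_apply]
  have hv : ∀ c x j, v j (E (c, x)) = c j := fun c x j ↦ by
    rw [hE, map_add, (hN x).1 x.2 j]
    simp [h]
  have bij : Function.Bijective E := by
    constructor
    · rw [← LinearMap.ker_eq_bot, LinearMap.ker_eq_bot']
      rintro ⟨c, x⟩ hx
      have hc : c = 0 := by
        ext j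
        rw [← hv c x j, hx, map_zero, Pi.zero_apply]
      subst hc
      rw [hE] at hx
      simpa using hx
    · intro y
      refine ⟨(fun j ↦ v j y, ⟨y - ∑ i, v i y • e i, ?_⟩), ?_⟩
      · rw [hN]
        intro j
        simp [h]
      · rw [hE]
        simp
  let Nb := Module.finBasis K N
  refine ⟨_, ((Pi.basisFun K (Fin n)).prod Nb).map (LinearEquiv.ofBijective E bij), ?_, ?_⟩
  · intro i
    simp [hE, Pi.single_apply]
  · intro k j
    simp [hv]

/-- Used to reorder a tuple of basis vectors so that each `e l` occurring in it stands in slot `l`.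
-/
theorem exists_perm_eq_inl {n : ℕ} {ι : Type*} {f : Fin n → Fin n ⊕ ι}
    (hf : Function.Injective f) :
    ∃ σ : Equiv.Perm (Fin n), ∀ j l, f (σ j) = Sum.inl l → l = j := by
  classical
  let g : {i // (f i).isLeft} → Fin n := fun i ↦ (f i.1).getLeft i.2
  have hg : ∀ i, f i.1 = Sum.inl (g i) := fun i ↦ (Sum.inl_getLeft _ i.2).symm
  have g_inj : Function.Injective g := by
    intro i i' h
    apply Subtype.ext
    apply hf
    rw [hg, hg, h]
  let ε : {i // (f i).isLeft} ≃ {x // x ∈ Set.range g} := Equiv.ofInjective g g_inj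
  let τ : Equiv.Perm (Fin n) := ε.extendSubtype
  refine ⟨τ.symm, fun j l h ↦ ?_⟩
  have hl : (f (τ.symm j)).isLeft := by rw [h]; rfl
  have h1 : τ (τ.symm j) = g ⟨τ.symm j, hl⟩ := ε.extendSubtype_apply_of_mem _ hl
  have h2 := hg ⟨τ.symm j, hl⟩
  rw [← h1, h, Equiv.apply_symm_apply] at h2
  exact Sum.inl_injective h2

variable {V : Type*} [AddCommGroup V] [Module K V] [FiniteDimensional K V]

theorem isSimple_of_threeTerm_eq_zero {P : ⋀[K]^(t + 2) V}
    (hP : ∀ a b c d α, threeTerm (dualForm P) a b c d α = 0) : IsSimple P := by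
  classical
  by_cases hP0 : P = 0
  · exact ⟨0, by rw [hP0, AlternatingMap.map_zero]⟩
  obtain ⟨e, he⟩ : ∃ e, dualForm P e = 1 := by
    by_contra! hne
    refine hP0 (eq_of_dualForm_eq fun ξ ↦ ?_)
    by_contra h
    rw [dualForm_apply (0 : ⋀[K]^(t + 2) V), map_zero] at h
    refine hne (Function.update ξ 0 ((dualForm P ξ)⁻¹ • ξ 0)) ?_
    rw [AlternatingMap.map_update_smul, Function.update_eq_self, smul_eq_mul,
      inv_mul_cancel₀ h]
  -- The factors of `P` are its contractions with all covectors of `e` but one, viewed in `V`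
  -- through the double dual.
  let v : Fin (t + 2) → Module.Dual K (Module.Dual K V) := fun j ↦
    (dualForm P).toMultilinearMap.toLinearMap e j
  have hv : ∀ j x, v j x = dualForm P (Function.update e j x) := fun j x ↦ rfl
  have hve : ∀ i j, v j (e i) = if i = j then 1 else 0 := by
    intro i j
    rw [hv]
    split_ifs with h
    · rw [h, Function.update_eq_self, he]
    · exact (dualForm P).map_update_self _ (Ne.symm h)
  let u : Fin (t + 2) → V := fun j ↦ (Module.evalEquiv K V).symm (v j)
  have hu : ∀ (ξ : Module.Dual K V) j, ξ (u j) = v j ξ := fun ξ j ↦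
    Module.apply_evalEquiv_symm_apply _ _ ξ (v j)
  obtain ⟨_, b, hbl, hbr⟩ := exists_basis_of_dual hve
  refine ⟨u, eq_of_dualForm_eq fun ξ ↦ ?_⟩
  suffices h : dualForm P = dualForm (exteriorPower.ιMulti K (t + 2) u) by rw [h]
  refine b.ext_alternating fun f hf ↦ ?_
  obtain ⟨σ, hσ⟩ := exists_perm_eq_inl hf
  have hperm : ∀ A : (Module.Dual K V) [⋀^Fin (t + 2)]→ₗ[K] K,
      A (fun i ↦ b (f i)) = Equiv.Perm.sign σ • A (fun i ↦ b (f (σ i))) := by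
    intro A
    have := A.map_perm (fun i ↦ b (f i)) σ
    rw [Function.comp_def] at this
    rw [this, smul_smul, Int.units_mul_self, one_smul]
  rw [hperm, hperm]
  congr 1
  rw [dualForm_ιMulti]
  by_cases hJ : ∀ j, (f (σ j)).isLeft
  · have h : (fun i ↦ b (f (σ i))) = e := by
      ext1 j
      have h1 := (Sum.inl_getLeft _ (hJ j)).symm
      rw [h1, hσ j _ h1, hbl]
    rw [h, he, ← Matrix.det_one (n := Fin (t + 2))]
    congr 1
    ext i j
    simp only [congrFun h, Matrix.of_apply, hu, hve, Matrix.one_apply, eq_comm]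
  -- The value `0` in the unused slots keeps every `n k` in the common kernel of the `v j`.
  · let n : Fin (t + 2) → Module.Dual K V :=
      fun j ↦ if (f (σ j)).isLeft then 0 else b (f (σ j))
    let J : Finset (Fin (t + 2)) := Finset.univ.filter fun j ↦ ¬ (f (σ j)).isLeft
    push Not at hJ
    obtain ⟨j₀, hj₀⟩ := hJ
    have hn : ∀ k i, dualForm P (Function.update e i (n k)) = 0 := by
      intro k i
      rw [← hv]
      by_cases h : (f (σ k)).isLeft
      · simp [n, h]
      · obtain ⟨l, hl⟩ := Sum.isRight_iff.1 (Sum.not_isLeft.1 h)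
        simp [n, hl, hbr]
    have hx : (fun i ↦ b (f (σ i))) = J.piecewise n e := by
      ext1 j
      by_cases h : (f (σ j)).isLeft
      · have h1 := (Sum.inl_getLeft _ h).symm
        rw [Finset.piecewise_eq_of_notMem _ _ _ (by simp [J, h])]
        rw [h1, hσ j _ h1, hbl]
      · rw [Finset.piecewise_eq_of_mem _ _ _ (by simpa [J] using h)]
        simp [n, h]
    rw [hx, map_piecewise_eq_zero hP J ⟨j₀, by simpa [J] using hj₀⟩ e (by simp [he]) hn]
    symm
    refine Matrix.det_eq_zero_of_column_eq_zero j₀ fun i ↦ ?_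
    obtain ⟨l, hl⟩ := Sum.isRight_iff.1 (Sum.not_isLeft.1 hj₀)
    simp only [Matrix.of_apply]
    rw [hu, hl, hbr]

end Decomposable

/-! ### Vanishing of components by a weight argument. -/

section Vanishing

variable {K V : Type*} [Field K] [AddCommGroup V] [Module K V]

/-- The diagonal automorphism which multiplies the basis vectors by the given units. -/
def diagonalGL {ι : Type*} (b : Module.Basis ι K V) (c : ι → Kˣ) :
    LinearMap.GeneralLinearGroup K V :=
  LinearMap.GeneralLinearGroup.ofLinearEquiv (b.equiv (b.unitsSMul c) (Equiv.refl ι))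

theorem diagonalGL_apply {ι : Type*} (b : Module.Basis ι K V) (c : ι → Kˣ) (i : ι) :
    (diagonalGL b c : V →ₗ[K] V) (b i) = (c i : K) • b i := by
  have : (diagonalGL b c : V →ₗ[K] V) (b i) = b.equiv (b.unitsSMul c) (Equiv.refl ι) (b i) := rfl
  rw [this, Module.Basis.equiv_apply, Equiv.refl_apply, Module.Basis.unitsSMul_apply]
  rfl

theorem ιMulti_diagonalGL {ι : Type*} (b : Module.Basis ι K V) (c : ι → Kˣ) {p : ℕ}
    (f : Fin p → ι) :
    exteriorPower.ιMulti K p (fun i ↦ (diagonalGL b c : V →ₗ[K] V) (b (f i))) =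
      (∏ i, (c (f i) : K)) • exteriorPower.ιMulti K p (fun i ↦ b (f i)) := by
  simp only [diagonalGL_apply]
  exact (exteriorPower.ιMulti K p).toMultilinearMap.map_smul_univ _ _

theorem extTensor_ext_basis {ι : Type*} (b : Module.Basis ι K V) {p q : ℕ} {N : Type*}
    [AddCommGroup N] [Module K N] {f g : (⋀[K]^p V) ⊗[K] (⋀[K]^q V) →ₗ[K] N}
    (h : ∀ (v : Fin p → ι) (w : Fin q → ι), Function.Injective v →
      f (exteriorPower.ιMulti K p (fun i ↦ b (v i)) ⊗ₜ
        exteriorPower.ιMulti K q (fun i ↦ b (w i))) =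
      g (exteriorPower.ιMulti K p (fun i ↦ b (v i)) ⊗ₜ
        exteriorPower.ιMulti K q (fun i ↦ b (w i)))) : f = g := by
  refine TensorProduct.ext (exteriorPower.linearMap_ext (b.ext_alternating fun v hv ↦ ?_))
  refine exteriorPower.linearMap_ext (b.ext_alternating fun w _ ↦ ?_)
  exact h v w hv

/-- If `P` only involves the basis vectors in a set of less than `s + k` elements, the component of
`P ⊗ P` in `Y^{s+k,s-k}` vanishes. -/
theorem squareComponentVanishes_of_mem_span [CharZero K] [FiniteDimensional K V] {ι : Type*}
    (b : Module.Basis ι K V) (S : Finset ι) {s k : ℕ} (hS : S.card < s + k) {P : ⋀[K]^s V}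
    (hP : P ∈ Submodule.span K
      {x | ∃ f : Fin s → ι, (∀ i, f i ∈ S) ∧ x = exteriorPower.ιMulti K s fun i ↦ b (f i)}) :
    SquareComponentVanishes P k := by
  classical
  intro f
  let n : ι → ℕ := fun i ↦ if i ∈ S then 0 else 1
  let c : ι → Kˣ := fun i ↦ (Units.mk0 2 two_ne_zero) ^ n i
  have hc : ∀ i, (c i : K) = 2 ^ n i := fun i ↦ by simp [c]
  let g := diagonalGL b c
  have hgP : extRep K V s g P = P := by
    induction hP using Submodule.span_induction with
    | zero => simp
    | add x y _ _ hx hy => rw [map_add, hx, hy]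
    | smul a x _ hx => rw [map_smul, hx]
    | mem x hx =>
      obtain ⟨v, hv, rfl⟩ := hx
      refine (exteriorPower.map_apply_ιMulti _ _).trans ?_
      refine (ιMulti_diagonalGL b c v).trans ?_
      simp [hc, n, hv]
  have hgPP : extTensorRep K V s s g (P ⊗ₜ P) = P ⊗ₜ P := by
    refine (TensorProduct.map_tmul _ _ _ _).trans ?_
    rw [hgP]
  set y := f (P ⊗ₜ P) with hy
  have hgy : YRep K V (s + k) (s - k) g y = y := by
    rw [hy, ← Representation.IntertwiningMap.isIntertwining, hgPP]
  -- Each basis tensor is an eigenvector of `g` with eigenvalue `2 ^ m`, `m > 0`, so `D` is onto.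
  -- This passes to the quotient, where finite dimension makes it injective and kills the fixed
  -- vector `y`.
  let D := extTensorRep K V (s + k) (s - k) g - LinearMap.id
  have hD : (LinearMap.range D).mkQ = 0 := by
    refine extTensor_ext_basis b fun v w hv ↦ ?_
    rw [LinearMap.zero_apply, Submodule.mkQ_apply, Submodule.Quotient.mk_eq_zero]
    obtain ⟨i, hi⟩ : ∃ i, v i ∉ S := by
      by_contra! h
      have := Finset.card_le_card_of_injOn (s := Finset.univ) v (fun i _ ↦ h i) hv.injOn
      simp at this
      omega
    set x := exteriorPower.ιMulti K (s + k) (fun i ↦ b (v i)) ⊗ₜ[K]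
      exteriorPower.ιMulti K (s - k) (fun i ↦ b (w i)) with hx
    obtain ⟨m, hm, hgx⟩ : ∃ m, 0 < m ∧ D x = (2 ^ m - 1 : K) • x := by
      refine ⟨∑ i, n (v i) + ∑ i, n (w i), ?_, ?_⟩
      · have h1 : n (v i) ≤ ∑ i, n (v i) :=
          Finset.single_le_sum (f := fun i ↦ n (v i)) (fun _ _ ↦ Nat.zero_le _) (Finset.mem_univ i)
        have h2 : n (v i) = 1 := by simp [n, hi]
        omega
      · have : extTensorRep K V (s + k) (s - k) g x =
            (2 ^ (∑ i, n (v i) + ∑ i, n (w i)) : K) • x := by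
          rw [hx, extTensorRep_ιMulti, ιMulti_diagonalGL, ιMulti_diagonalGL,
            TensorProduct.smul_tmul_smul, pow_add, ← Finset.prod_pow_eq_pow_sum,
            ← Finset.prod_pow_eq_pow_sum]
          simp only [hc]
        rw [LinearMap.sub_apply, this, LinearMap.id_apply, sub_smul, one_smul]
    have hm1 : (2 ^ m - 1 : K) ≠ 0 := by
      rw [sub_ne_zero]
      exact_mod_cast (Nat.one_lt_two_pow hm.ne').ne'
    exact ⟨(2 ^ m - 1 : K)⁻¹ • x, by rw [map_smul, hgx, smul_smul, inv_mul_cancel₀ hm1, one_smul]⟩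
  have hsurj : Function.Surjective
      (YRep K V (s + k) (s - k) g - LinearMap.id : Y K V (s + k) (s - k) →ₗ[K] _) := by
    intro z
    obtain ⟨x, rfl⟩ := (exchangeRelations K V (s + k) (s - k)).mkQ_surjective z
    have hx : x ∈ LinearMap.range D := by
      rw [← Submodule.Quotient.mk_eq_zero, ← Submodule.mkQ_apply, hD, LinearMap.zero_apply]
    obtain ⟨x', rfl⟩ := hx
    exact ⟨(exchangeRelations K V (s + k) (s - k)).mkQ x', rfl⟩
  refine LinearMap.injective_iff_surjective.2 hsurj ?_
  rw [map_zero, LinearMap.sub_apply, hgy, LinearMap.id_apply, sub_self]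

theorem IsSimple.squareComponentVanishes [CharZero K] [FiniteDimensional K V] {s k : ℕ}
    (hk : k ≠ 0) {P : ⋀[K]^s V} (hP : IsSimple P) : SquareComponentVanishes P k := by
  classical
  obtain ⟨v, rfl⟩ := hP
  by_cases hv : LinearIndependent K v
  · refine squareComponentVanishes_of_mem_span (Module.Basis.sumExtend hv)
      (Finset.univ.image Sum.inl) (lt_of_le_of_lt Finset.card_image_le ?_)
      (Submodule.subset_span ⟨Sum.inl, fun i ↦ by simp, ?_⟩)
    · simp
      omega
    · congr 1
      ext1 i
      simp only [Module.Basis.sumExtend, Module.Basis.reindex_apply, Module.Basis.extend_apply_self]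
      rfl
  · intro f
    rw [AlternatingMap.map_linearDependent _ _ hv, TensorProduct.zero_tmul, map_zero]

end Vanishing

/-! ### A non-simple multivector on `s + 2` basis vectors. -/

section Optimality

variable {K V : Type*} [Field K] [AddCommGroup V] [Module K V]

theorem dualForm_coord_ιMulti {ι : Type*} (b : Module.Basis ι K V) {s : ℕ} {f g : Fin s → ι}
    {i : Fin s} (h : ∀ j, g j ≠ f i) :
    dualForm (exteriorPower.ιMulti K s fun j ↦ b (g j)) (fun j ↦ b.coord (f j)) = 0 := by
  rw [dualForm_ιMulti]
  exact Matrix.det_eq_zero_of_column_eq_zero i fun j ↦ by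
    simp [h j]

theorem dualForm_coord_ιMulti_self {ι : Type*} (b : Module.Basis ι K V) {s : ℕ} {f : Fin s → ι}
    (h : Function.Injective f) :
    dualForm (exteriorPower.ιMulti K s fun j ↦ b (f j)) (fun j ↦ b.coord (f j)) = 1 := by
  classical
  rw [dualForm_ιMulti, ← Matrix.det_one (n := Fin s)]
  congr 1
  ext i j
  simp [Finsupp.single_apply, h.eq_iff, Matrix.one_apply]

/-- The `(t+2)`-vector `(e₀ ∧ e₁ + e₂ ∧ e₃) ∧ e₄ ∧ ⋯` is not simple, although all components of its
square beyond the one in `Y^{t+4,t}` vanish. -/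
theorem exists_not_isSimple [CharZero K] [FiniteDimensional K V] {t : ℕ}
    (ht : t + 4 ≤ Module.finrank K V) :
    ∃ P : ⋀[K]^(t + 2) V, (∀ k, 2 < k → SquareComponentVanishes P k) ∧ ¬ IsSimple P := by
  classical
  let b := Module.finBasis K V
  let c : Fin (t + 4) → Fin (Module.finrank K V) := Fin.castLE ht
  have hc : Function.Injective c := Fin.castLE_injective ht
  let p : Fin 4 → Fin (t + 4) := Fin.castLE (by omega)
  have hp : Function.Injective p := Fin.castLE_injective _
  let α : Fin t → Fin (t + 4) := fun k ↦ k.succ.succ.succ.succ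
  have hα : Function.Injective α := fun k l h ↦ by simpa [α] using h
  have hpα : ∀ i k, α k ≠ p i := fun i k h ↦ by
    have := congrArg Fin.val h
    simp only [α, p, Fin.val_succ, Fin.val_castLE] at this
    omega
  let F : Fin 4 → Fin 4 → Fin (t + 2) → Fin (t + 4) := fun i j ↦
    Matrix.vecCons (p i) (Matrix.vecCons (p j) α)
  have hF : ∀ i j, i ≠ j → Function.Injective (F i j) := fun i j hij ↦ by
    refine Fin.cons_injective_iff.2 ⟨?_, Fin.cons_injective_iff.2 ⟨?_, hα⟩⟩
    · rintro ⟨k, hk⟩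
      refine Fin.cases (fun h ↦ hij (hp h).symm) (fun k h ↦ hpα i k h) k hk
    · rintro ⟨k, hk⟩
      exact hpα j k hk
  have hne : ∀ i j l, i ≠ l → j ≠ l → ∀ k, c (F i j k) ≠ c (p l) := fun i j l hi hj k h ↦ by
    refine Fin.cases (fun h ↦ hi (hp h)) (fun k ↦ Fin.cases (fun h ↦ hj (hp h))
      (fun k h ↦ hpα l k h) k) k (hc h)
  let m : Fin 4 → Fin 4 → ⋀[K]^(t + 2) V := fun i j ↦
    exteriorPower.ιMulti K (t + 2) fun k ↦ b (c (F i j k))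
  let ξ : Fin (t + 4) → Module.Dual K V := fun i ↦ b.coord (c i)
  have hξ : ∀ i j, Matrix.vecCons (ξ (p i)) (Matrix.vecCons (ξ (p j)) fun k ↦ ξ (α k)) =
      fun k ↦ b.coord (c (F i j k)) := by
    intro i j
    ext1 k
    refine Fin.cases rfl (fun k ↦ Fin.cases rfl (fun k ↦ rfl) k) k
  have hone : ∀ i j, i ≠ j → dualForm (m i j) (fun k ↦ b.coord (c (F i j k))) = 1 :=
    fun i j hij ↦ dualForm_coord_ιMulti_self b (hc.comp (hF i j hij))
  have hleft : ∀ i j i' j', i' ≠ i → j' ≠ i →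
      dualForm (m i' j') (fun k ↦ b.coord (c (F i j k))) = 0 := fun i j i' j' h h' ↦
    dualForm_coord_ιMulti b (f := fun k ↦ c (F i j k)) (i := 0) (hne i' j' i h h')
  have hright : ∀ i j i' j', i' ≠ j → j' ≠ j →
      dualForm (m i' j') (fun k ↦ b.coord (c (F i j k))) = 0 := fun i j i' j' h h' ↦
    dualForm_coord_ιMulti b (f := fun k ↦ c (F i j k)) (i := Fin.succ 0) (hne i' j' j h h')
  refine ⟨m 0 1 + m 2 3, fun k hk ↦ ?_, fun h ↦ ?_⟩
  · refine squareComponentVanishes_of_mem_span b (Finset.univ.image c)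
      (lt_of_le_of_lt Finset.card_image_le ?_) (add_mem ?_ ?_)
    · rw [Finset.card_univ, Fintype.card_fin]
      omega
    · exact Submodule.subset_span ⟨fun k ↦ c (F 0 1 k), fun k ↦ by simp, rfl⟩
    · exact Submodule.subset_span ⟨fun k ↦ c (F 2 3 k), fun k ↦ by simp, rfl⟩
  -- At the dual basis the first product of the three-term expression is `1` and the other two are
  -- `0`.
  · have h1 := (h.squareComponentVanishes two_ne_zero).threeTerm_eq_zero
      (ξ (p 0)) (ξ (p 1)) (ξ (p 2)) (ξ (p 3)) (fun k ↦ ξ (α k))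
    simp only [threeTerm, hξ, dualForm_add] at h1
    rw [hone 0 1 (by decide), hone 2 3 (by decide), hleft 0 1 2 3 (by decide) (by decide),
      hleft 2 3 0 1 (by decide) (by decide), hright 0 2 0 1 (by decide) (by decide),
      hleft 0 2 2 3 (by decide) (by decide), hright 0 3 0 1 (by decide) (by decide),
      hleft 0 3 2 3 (by decide) (by decide)] at h1
    simp at h1

end Optimality

end Plucker

end

/-! ### The characterization and its optimality. -/

theorem theorem2 {K V : Type*} [Field K] [CharZero K] [AddCommGroup V] [Module K V]
    [FiniteDimensional K V] (s : ℕ) (hs : 2 ≤ s) :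
    (∀ P : ⋀[K]^s V, Plucker.IsSimple P ↔ Plucker.SquareComponentVanishes P 2) ∧
    -- optimality: any non-empty set of other (non-zero) components of the symmetric square
    (∀ J : Set ℕ, J.Nonempty →
      (∀ k ∈ J, Even k ∧ k ≠ 2 ∧ k ≤ s ∧ s + k ≤ Module.finrank K V) →
      (∃ P : ⋀[K]^s V, (∀ k ∈ J, Plucker.SquareComponentVanishes P k) ∧ ¬ Plucker.IsSimple P) ∨
      (∀ P : ⋀[K]^s V, (∀ k ∈ J, Plucker.SquareComponentVanishes P k) → P = 0)) := by
  obtain ⟨t, rfl⟩ := Nat.exists_eq_add_of_le' hs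
  refine ⟨fun P ↦ ⟨fun h ↦ h.squareComponentVanishes two_ne_zero, fun h ↦
    Plucker.isSimple_of_threeTerm_eq_zero h.threeTerm_eq_zero⟩, fun J hJ hJk ↦ ?_⟩
  by_cases h0 : 0 ∈ J
  · exact Or.inr fun P hP ↦ (hP 0 h0).eq_zero
  have hlt : ∀ k ∈ J, 2 < k := by
    intro k hk
    obtain ⟨⟨r, rfl⟩, h2, -, -⟩ := hJk k hk
    have : r + r ≠ 0 := fun h ↦ h0 (h ▸ hk)
    omega
  obtain ⟨k, hk⟩ := hJ
  have ht : t + 4 ≤ Module.finrank K V := by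
    have := (hJk k hk).2.2.2
    have := hlt k hk
    omega
  obtain ⟨P, hP, hPs⟩ := Plucker.exists_not_isSimple (K := K) ht
  exact Or.inl ⟨P, fun k hk ↦ hP k (hlt k hk), hPs⟩
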